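/- Let $\Lambda = \{2n_1\omega_1 + 2n_2\omega_2 : n_1, n_2 \in \mathbb{Z}\} \subset \mathbb{C}$ be any lattice, where $\omega_1, \omega_2 \in \mathbb{C}$ are linearly independent over $\mathbb{R}$, and let $\omega_3 = -\omega_1 - \omega_2$. Let $$\wp(z) = z^{-2} + \sum_{0 \neq \lambda \in \Lambda} \{(z-\lambda)^{-2} - \lambda^{-2}\}, \qquad g_3 = 140 \sum_{0 \neq \lambda \in \Lambda} \lambda^{-6}$$ be the associated Weierstrass function and invariant, and let $e_p = \wp(\omega_p)$ for $p = 1, 2, 3$ be the midpoint constants. A meromorphic square root of a meromorphic function $f$ on $\mathbb{C}$ is a meromorphic function $J$ on $\mathbb{C}$ with $J^2 = f$ (an identity of meromorphic functions). The primitive function $J_p$ is the meromorphic square root of $\wp - e_p$ that satisfies $z J_p(z) \to 1$ as $z \to 0$. (i) If $g_3 = 0$, then exactly one of the midpoint constants $e_1, e_2, e_3$ vanishes. If $e_p$ is the one that vanishes, then $\omega_p$ is a double zero of $\wp$, the primitive function $J_p$ exists and is unique, and $J_p$ is a meromorphic square root of $\wp$ on $\mathbb{C}$. (ii) If $g_3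 \neq 0$, then none of the midpoint constants vanishes, all zeros of $\wp$ are simple, and $\wp$ has no meromorphic square root on $\mathbb{C}$. In particular, $\wp$ has a meromorphic square root on $\mathbb{C}$ if and only if $g_3 = 0$. -/

import Mathlib

open Filter Topology

namespace PeriodPair

/-- The half periods `ω₁, ω₂, ω₃` with `ω₁ + ω₂ + ω₃ = 0`, the lattice being generated by
`2 * ω₁` and `2 * ω₂`. (The fields `L.ω₁`, `L.ω₂` of a `PeriodPair` are full periods.) -/
noncomputable def halfPeriod (L : PeriodPair) : Fin 3 → ℂ :=
  ![L.ω₁ / 2, L.ω₂ / 2, -(L.ω₁ / 2 + L.ω₂ / 2)]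

/-- The midpoint constants `e₁, e₂, e₃`: the values of `℘` at the half periods. -/
noncomputable def midpointConstant (L : PeriodPair) (p : Fin 3) : ℂ :=
  L.weierstrassP (L.halfPeriod p)

end PeriodPair

/-- `J` is a (global) meromorphic square root of the meromorphic function `f` on the plane:
`J` is meromorphic on all of `ℂ` and `J ^ 2 = f` as meromorphic functions, that is, pointwise
off a closed discrete set (the values of meromorphic functions at poles are conventional). -/
def IsMeromorphicSqrt (J f : ℂ → ℂ) : Prop :=
  Meromorphic J ∧ (fun z => J z ^ 2) =ᶠ[codiscrete ℂ] f

/-- `J` is the primitive function `J_p` of the lattice: the meromorphic square root of `℘ - e_p`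
with `z * J z → 1` as `z → 0`. Being in normal form fixes the values of `J` everywhere (the
continuous ones off the poles, and `0` at the poles), so that a meromorphic function is the same
as an honest function. -/
def PeriodPair.IsPrimitiveFunction (L : PeriodPair) (p : Fin 3) (J : ℂ → ℂ) : Prop :=
  MeromorphicNFOn J Set.univ ∧
    IsMeromorphicSqrt J (fun z => L.weierstrassP z - L.midpointConstant p) ∧
    Tendsto (fun z => z * J z) (𝓝[≠] 0) (𝓝 1)

/-!
For a half period `h`, the elliptic function `(℘ z - ℘ h) * (℘ (z + h) - ℘ h)` has no poles, since
`℘'` vanishes at `h`, so it is a nonzero constant. Hence `℘ - ℘ h` has a double zero at `h` and no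
zeros off `h + Λ`. The midpoint constants are therefore the three distinct roots of
`4 x³ - g₂ x - g₃`, so that `g₃ = 4 e₁ e₂ e₃`. An elliptic function with a pole has a zero, and at a
zero of `℘` the square of `℘'` is `-g₃`; for `g₃ ≠ 0` the zero is simple and `℘` is not a square.

To construct `J_p`, write `Λ = M ∪ (h + M)` with `2 * ω_p ∈ M` and `2 * h ∈ M`, and let `J` be
`-1 / 2` times the logarithmic derivative of `℘_M - ℘_M h`. Since the product of `℘_M - ℘_M h` and
its translate by `h` is constant, `J (z + h) = -J z`, so `J ^ 2` has all periods in `Λ`. The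
difference of `J ^ 2` and `℘ + 2 * ℘_M h` has no poles and tends to `0` at the origin, so it
vanishes. Finally `J` is odd with periods `M`, so `J` is zero at `ω_p`, and `e_p = -2 * ℘_M h`.
-/

section Codiscrete

variable {X Y Z : Type*} [TopologicalSpace X] [TopologicalSpace Y]

theorem eventuallyEq_codiscrete_iff_nhdsNE {f g : X → Z} :
    f =ᶠ[codiscrete X] g ↔ ∀ x, f =ᶠ[𝓝[≠] x] g := by
  simp only [EventuallyEq, Filter.Eventually, mem_codiscrete, disjoint_principal_right, compl_compl]

theorem tendsto_codiscrete_of_homeomorph (e : X ≃ₜ Y) :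
    Tendsto e (codiscrete X) (codiscrete Y) := by
  intro s hs
  simp only [mem_map, mem_codiscrete, disjoint_principal_right, compl_compl] at hs ⊢
  intro x
  rw [← mem_map, e.map_punctured_nhds_eq]
  exact hs (e x)

end Codiscrete

section Meromorphic

variable {𝕜 E : Type*} [NontriviallyNormedField 𝕜] [NormedAddCommGroup E] [NormedSpace 𝕜 E]

theorem eventuallyEq_codiscrete_of_nhdsNE [CompleteSpace E] [ConnectedSpace 𝕜] {f g : 𝕜 → E}
    (hf : Meromorphic f) (hg : Meromorphic g) {x : 𝕜} (h : f =ᶠ[𝓝[≠] x] g) :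
    f =ᶠ[codiscrete 𝕜] g := by
  rw [eventuallyEq_codiscrete_iff_nhdsNE]
  intro y
  rw [eventuallyEq_iff_sub] at h ⊢
  change ∀ᶠ z in 𝓝[≠] y, (f - g) z = 0
  rw [← meromorphicOrderAt_eq_top_iff]
  by_contra hy
  exact ((hf.sub hg).meromorphicOn.meromorphicOrderAt_ne_top_of_isPreconnected isPreconnected_univ
    (Set.mem_univ y) (Set.mem_univ x) hy) (meromorphicOrderAt_eq_top_iff.mpr h)

theorem eq_of_meromorphicNFOn_univ {f g : 𝕜 → E} (hf : MeromorphicNFOn f Set.univ)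
    (hg : MeromorphicNFOn g Set.univ) (h : f =ᶠ[codiscrete 𝕜] g) : f = g := by
  funext x
  have hx := eventuallyEq_codiscrete_iff_nhdsNE.mp h x
  exact (((hf (Set.mem_univ x)).eventuallyEq_nhdsNE_iff_eventuallyEq_nhds
    (hg (Set.mem_univ x))).mp hx).eq_of_nhds

theorem meromorphicOrderAt_comp_add_const (f : 𝕜 → E) (a x : 𝕜) :
    meromorphicOrderAt (fun z ↦ f (z + a)) x = meromorphicOrderAt f (x + a) :=
  meromorphicOrderAt_comp_add_const_eq_meromorphicOrderAt

theorem logDeriv_comp_add_const {𝕜' : Type*} [NontriviallyNormedField 𝕜'] [NormedAlgebra 𝕜 𝕜']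
    (f : 𝕜 → 𝕜') (a x : 𝕜) : logDeriv (fun z ↦ f (z + a)) x = logDeriv f (x + a) := by
  rw [logDeriv_apply, logDeriv_apply, deriv_comp_add_const]

theorem tendsto_mul_logDeriv_of_meromorphicOrderAt [CompleteSpace 𝕜] {f : 𝕜 → 𝕜} {x : 𝕜} {n : ℤ}
    (hf : MeromorphicAt f x) (hn : meromorphicOrderAt f x = n) :
    Tendsto (fun z ↦ (z - x) * logDeriv f z) (𝓝[≠] x) (𝓝 n) := by
  obtain ⟨g, hg, hgx, hfg⟩ := (meromorphicOrderAt_eq_int_iff hf).mp hn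
  have hcont : ContinuousAt (fun z ↦ n + (z - x) * logDeriv g z) x := by
    have : ContinuousAt (logDeriv g) x := hg.deriv.continuousAt.div hg.continuousAt hgx
    fun_prop
  have hlim := hcont.tendsto.mono_left (nhdsWithin_le_nhds (s := {x}ᶜ))
  simp only [sub_self, zero_mul, add_zero] at hlim
  refine hlim.congr' ?_
  have hg_near : ∀ᶠ z in 𝓝[≠] x, AnalyticAt 𝕜 g z ∧ g z ≠ 0 :=
    (hg.eventually_analyticAt.and (hg.continuousAt.eventually_ne hgx)).filter_mono
      nhdsWithin_le_nhds
  have hlog : logDeriv f =ᶠ[𝓝[≠] x] logDeriv (fun z ↦ (z - x) ^ n * g z) :=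
    logDeriv_congr_nhdsNE hfg
  filter_upwards [hlog, hg_near, self_mem_nhdsWithin] with z hz ⟨hgz, hgz0⟩ hzx
  have hzx : z - x ≠ 0 := sub_ne_zero.mpr hzx
  have hpow : logDeriv (fun z ↦ (z - x) ^ n) z = n / (z - x) := by
    rw [logDeriv_fun_zpow (by fun_prop), logDeriv_apply]
    simp [div_eq_mul_inv]
  rw [hz, logDeriv_mul (f := fun z ↦ (z - x) ^ n) z (zpow_ne_zero n hzx) hgz0
    (by fun_prop (disch := simp [hzx])) hgz.differentiableAt, hpow, mul_add, mul_div_cancel₀ _ hzx]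

theorem two_le_meromorphicOrderAt_sub_of_deriv_eq_zero [CharZero 𝕜] [CompleteSpace E] {f : 𝕜 → E}
    {x : 𝕜} (hf : AnalyticAt 𝕜 f x) (hx : deriv f x = 0) :
    2 ≤ meromorphicOrderAt (fun z ↦ f z - f x) x := by
  have hsub : AnalyticAt 𝕜 (fun z ↦ f z - f x) x := hf.sub analyticAt_const
  have horder : (2 : ℕ) ≤ analyticOrderAt (fun z ↦ f z - f x) x := by
    rw [natCast_le_analyticOrderAt_iff_iteratedDeriv_eq_zero hsub]
    intro i hi
    interval_cases i
    · simp
    · simp [hx]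
  rw [hsub.meromorphicOrderAt_eq]
  exact ENat.monotone_map_iff.mpr (fun _ _ h ↦ Int.ofNat_le.mpr h) horder

end Meromorphic

namespace IsMeromorphicSqrt

variable {J K f : ℂ → ℂ}

theorem meromorphicOrderAt_eq (hJ : IsMeromorphicSqrt J f) (z : ℂ) :
    meromorphicOrderAt f z = 2 * meromorphicOrderAt J z := by
  rw [← meromorphicOrderAt_congr (eventuallyEq_codiscrete_iff_nhdsNE.mp hJ.2 z)]
  exact meromorphicOrderAt_pow (hJ.1 z)

theorem meromorphicOrderAt_ne_one (hJ : IsMeromorphicSqrt J f) (z : ℂ) :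
    meromorphicOrderAt f z ≠ 1 := by
  rw [hJ.meromorphicOrderAt_eq z]
  cases meromorphicOrderAt J z with
  | top => decide
  | coe n =>
    intro h
    have : 2 * n = 1 := WithTop.coe_injective h
    lia

theorem congr_left (hJ : IsMeromorphicSqrt J f) (hK : Meromorphic K) (h : J =ᶠ[codiscrete ℂ] K) :
    IsMeromorphicSqrt K f :=
  ⟨hK, (h.fun_comp (· ^ 2)).symm.trans hJ.2⟩

theorem eventuallyEq_of_tendsto (hJ : IsMeromorphicSqrt J f) (hK : IsMeromorphicSqrt K f)
    {u : ℂ → ℂ} {x a : ℂ} (ha : a ≠ 0) (hJa : Tendsto (fun z ↦ u z * J z) (𝓝[≠] x) (𝓝 a))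
    (hKa : Tendsto (fun z ↦ u z * K z) (𝓝[≠] x) (𝓝 a)) : J =ᶠ[codiscrete ℂ] K := by
  refine eventuallyEq_codiscrete_of_nhdsNE hJ.1 hK.1 (x := x) ?_
  have hsum : ∀ᶠ z in 𝓝[≠] x, u z * J z + u z * K z ≠ 0 :=
    (hJa.add hKa).eventually_ne (by simpa [← two_mul] using ha)
  have hsq := eventuallyEq_codiscrete_iff_nhdsNE.mp (hJ.2.trans hK.2.symm) x
  filter_upwards [hsum, hsq] with z hz hsqz
  rcases sq_eq_sq_iff_eq_or_eq_neg.mp hsqz with h | h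
  · exact h
  · simp [h] at hz

end IsMeromorphicSqrt

theorem constCoeff_eq_of_cubic_roots {R : Type*} [CommRing R] [NoZeroDivisors R] {a b c d x y z : R}
    (hxy : x ≠ y) (hxz : x ≠ z) (hyz : y ≠ z) (hx : a * x ^ 3 + b * x ^ 2 + c * x + d = 0)
    (hy : a * y ^ 3 + b * y ^ 2 + c * y + d = 0) (hz : a * z ^ 3 + b * z ^ 2 + c * z + d = 0) :
    d = -(a * (x * y * z)) := by
  have hxy' : a * (x ^ 2 + x * y + y ^ 2) + b * (x + y) + c = 0 :=
    mul_left_cancel₀ (sub_ne_zero.mpr hxy) (by linear_combination hx - hy)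
  have hxz' : a * (x ^ 2 + x * z + z ^ 2) + b * (x + z) + c = 0 :=
    mul_left_cancel₀ (sub_ne_zero.mpr hxz) (by linear_combination hx - hz)
  have hsum : a * (x + y + z) + b = 0 :=
    mul_left_cancel₀ (sub_ne_zero.mpr hyz) (by linear_combination hxy' - hxz')
  linear_combination hx - x * hxy' + x * y * hsum

section Elliptic

variable {E : Type*} [NormedAddCommGroup E] [NormedSpace ℂ E]

/-- `F` is an elliptic function for the lattice `Λ`: a meromorphic function with periods `Λ`. Since
the values of meromorphic functions at poles are conventional, periodicity is an identity of
meromorphic functions, valid off a closed discrete set. -/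
structure IsElliptic (Λ : Submodule ℤ ℂ) (F : ℂ → E) : Prop where
  meromorphic : Meromorphic F
  periodic : ∀ l ∈ Λ, (fun z ↦ F (z + l)) =ᶠ[codiscrete ℂ] F

namespace IsElliptic

variable {Λ : Submodule ℤ ℂ} {F : ℂ → E} {f g : ℂ → ℂ}

theorem sub {G : ℂ → E} (hF : IsElliptic Λ F) (hG : IsElliptic Λ G) :
    IsElliptic Λ (fun z ↦ F z - G z) :=
  ⟨hF.meromorphic.sub hG.meromorphic, fun l hl ↦ (hF.periodic l hl).sub (hG.periodic l hl)⟩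

theorem mul (hf : IsElliptic Λ f) (hg : IsElliptic Λ g) : IsElliptic Λ (fun z ↦ f z * g z) :=
  ⟨hf.meromorphic.mul hg.meromorphic, fun l hl ↦ (hf.periodic l hl).mul (hg.periodic l hl)⟩

theorem inv (hf : IsElliptic Λ f) : IsElliptic Λ f⁻¹ :=
  ⟨hf.meromorphic.inv, fun l hl ↦ (hf.periodic l hl).inv⟩

theorem comp_add_const (hF : IsElliptic Λ F) (a : ℂ) : IsElliptic Λ (fun z ↦ F (z + a)) where
  meromorphic := Meromorphic.meromorphic_fun_comp_add_const_iff_meromorphic.mpr hF.meromorphic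
  periodic l hl := by
    simp only [add_right_comm _ l a]
    exact (hF.periodic l hl).comp_tendsto
      (tendsto_codiscrete_of_homeomorph (Homeomorph.addRight a))

theorem meromorphicOrderAt_add_mem (hF : IsElliptic Λ F) (z : ℂ) {l : ℂ} (hl : l ∈ Λ) :
    meromorphicOrderAt F (z + l) = meromorphicOrderAt F z := by
  rw [← meromorphicOrderAt_comp_add_const]
  exact meromorphicOrderAt_congr (eventuallyEq_codiscrete_iff_nhdsNE.mp (hF.periodic l hl) z)

theorem meromorphicOrderAt_ne_top [CompleteSpace E] (hF : IsElliptic Λ F) (z : ℂ) {w : ℂ}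
    (h : meromorphicOrderAt F w ≠ ⊤) : meromorphicOrderAt F z ≠ ⊤ :=
  hF.meromorphic.meromorphicOn.meromorphicOrderAt_ne_top_of_isPreconnected isPreconnected_univ
    (Set.mem_univ w) (Set.mem_univ z) h

theorem exists_eventuallyEq_const [CompleteSpace E] [DiscreteTopology Λ] [IsZLattice ℝ Λ]
    (hF : IsElliptic Λ F) (hord : ∀ z, 0 ≤ meromorphicOrderAt F z) :
    ∃ c, F =ᶠ[codiscrete ℂ] fun _ ↦ c := by
  set g := toMeromorphicNFOn F Set.univ
  have hgNF : MeromorphicNFOn g Set.univ := meromorphicNFOn_toMeromorphicNFOn F Set.univ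
  have hgF : g =ᶠ[codiscrete ℂ] F :=
    (toMeromorphicNFOn_eqOn_codiscrete hF.meromorphic.meromorphicOn).symm
  have hgd : Differentiable ℂ g := fun z ↦ by
    refine AnalyticAt.differentiableAt ?_
    rw [← (hgNF (Set.mem_univ z)).meromorphicOrderAt_nonneg_iff_analyticAt,
      meromorphicOrderAt_congr (eventuallyEq_codiscrete_iff_nhdsNE.mp hgF z)]
    exact hord z
  have hgper (z l : ℂ) (hl : l ∈ Λ) : g (z + l) = g z := by
    have hshift : (fun w ↦ g (w + l)) =ᶠ[codiscrete ℂ] g :=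
      ((hgF.comp_tendsto (tendsto_codiscrete_of_homeomorph (Homeomorph.addRight l))).trans
        (hF.periodic l hl)).trans hgF.symm
    have hcont : Continuous fun w ↦ g (w + l) := hgd.continuous.comp (by fun_prop)
    exact ((hcont.continuousAt.eventuallyEq_nhds_iff_eventuallyEq_nhdsNE
      hgd.continuous.continuousAt).mp
      (eventuallyEq_codiscrete_iff_nhdsNE.mp hshift z)).eq_of_nhds
  have hbounded := (IsZLattice.isCompact_range_of_periodic Λ g hgd.continuous hgper).isBounded
  exact ⟨g 0, hgF.symm.trans (.of_eq (funext fun z ↦ hgd.apply_eq_apply_of_bounded hbounded z 0))⟩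

theorem exists_meromorphicOrderAt_pos [DiscreteTopology Λ] [IsZLattice ℝ Λ] (hf : IsElliptic Λ f)
    {w : ℂ} (hw : meromorphicOrderAt f w < 0) : ∃ z, 0 < meromorphicOrderAt f z := by
  classical
  by_contra! hnp
  obtain ⟨c, hc⟩ := hf.inv.exists_eventuallyEq_const fun z ↦ by
    rw [meromorphicOrderAt_inv]
    rcases (hnp z).lt_or_eq with h | h
    · exact (LinearOrderedAddCommGroupWithTop.neg_pos.mpr (.inl h)).le
    · simp [h]
  have hinv := meromorphicOrderAt_congr (eventuallyEq_codiscrete_iff_nhdsNE.mp hc w)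
  rw [meromorphicOrderAt_inv, meromorphicOrderAt_const] at hinv
  split_ifs at hinv
  · exact hw.ne_top (LinearOrderedAddCommGroupWithTop.neg_eq_top.mp hinv)
  · exact (LinearOrderedAddCommGroupWithTop.neg_pos.mpr (.inl hw)).ne' hinv

end IsElliptic

end Elliptic

section WeierstrassP

variable {L : PeriodPair} {a z : ℂ}

open scoped PeriodPair

theorem analyticAt_weierstrassP_sub_const (a : ℂ) (hz : z ∉ L.lattice) :
    AnalyticAt ℂ (fun w ↦ ℘[L] w - a) z :=
  (L.analyticOnNhd_weierstrassP z hz).sub analyticAt_const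

theorem isElliptic_weierstrassP_sub_const (L : PeriodPair) (a : ℂ) :
    IsElliptic L.lattice fun z ↦ ℘[L] z - a where
  meromorphic := L.meromorphic_weierstrassP.fun_sub (.const a)
  periodic l hl := .of_eq (funext fun z ↦ by rw [L.weierstrassP_add_coe z ⟨l, hl⟩])

theorem meromorphicOrderAt_weierstrassP_sub_const_of_mem (a : ℂ) (hz : z ∈ L.lattice) :
    meromorphicOrderAt (fun w ↦ ℘[L] w - a) z = -2 := by
  simp only [sub_eq_add_neg]
  rw [← L.order_weierstrassP z hz]
  refine meromorphicOrderAt_add_eq_left_of_lt (f₂ := fun _ ↦ -a) (.const _ _) ?_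
  rw [L.order_weierstrassP z hz]
  exact lt_of_lt_of_le (by decide) (analyticAt_const (v := -a)).meromorphicOrderAt_nonneg

theorem meromorphicOrderAt_weierstrassP_sub_const_ne_top (L : PeriodPair) (a z : ℂ) :
    meromorphicOrderAt (fun w ↦ ℘[L] w - a) z ≠ ⊤ := by
  refine (isElliptic_weierstrassP_sub_const L a).meromorphicOrderAt_ne_top z (w := 0) ?_
  rw [meromorphicOrderAt_weierstrassP_sub_const_of_mem a L.lattice.zero_mem]
  decide

theorem weierstrassP_eq_iff_meromorphicOrderAt_ne_zero (hz : z ∉ L.lattice) :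
    ℘[L] z = a ↔ meromorphicOrderAt (fun w ↦ ℘[L] w - a) z ≠ 0 := by
  have hNF := (analyticAt_weierstrassP_sub_const (L := L) a hz).meromorphicNFAt
  rw [ne_eq, hNF.meromorphicOrderAt_eq_zero_iff, not_not, sub_eq_zero]

theorem exists_weierstrassP_eq (L : PeriodPair) (a : ℂ) : ∃ z ∉ L.lattice, ℘[L] z = a := by
  obtain ⟨z, hz⟩ := (isElliptic_weierstrassP_sub_const L a).exists_meromorphicOrderAt_pos (w := 0)
    (by rw [meromorphicOrderAt_weierstrassP_sub_const_of_mem a L.lattice.zero_mem]; decide)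
  have hzL : z ∉ L.lattice := fun h ↦
    absurd (meromorphicOrderAt_weierstrassP_sub_const_of_mem a h ▸ hz) (by decide)
  exact ⟨z, hzL, (weierstrassP_eq_iff_meromorphicOrderAt_ne_zero hzL).mpr hz.ne'⟩

theorem derivWeierstrassP_eq_zero_of_two_mul_mem (hz : 2 * z ∈ L.lattice) : ℘'[L] z = 0 := by
  have hper := L.derivWeierstrassP_add_coe (-z) ⟨2 * z, hz⟩
  rw [show -z + 2 * z = z by ring, L.derivWeierstrassP_neg] at hper
  exact CharZero.eq_neg_self_iff.mp hper

theorem meromorphicOrderAt_weierstrassP_sub_const_mul_translate (L : PeriodPair) (h z : ℂ) :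
    meromorphicOrderAt (fun w ↦ (℘[L] w - ℘[L] h) * (℘[L] (w + h) - ℘[L] h)) z =
      meromorphicOrderAt (fun w ↦ ℘[L] w - ℘[L] h) z +
        meromorphicOrderAt (fun w ↦ ℘[L] w - ℘[L] h) (z + h) := by
  have hQ := isElliptic_weierstrassP_sub_const L (℘[L] h)
  rw [← meromorphicOrderAt_comp_add_const]
  exact meromorphicOrderAt_mul (hQ.meromorphic z) ((hQ.comp_add_const h).meromorphic z)

/-- `h` is a half period of the lattice of `L`: it represents a point of order two of the
quotient of `ℂ` by the lattice. -/
structure IsHalfPeriod (L : PeriodPair) (h : ℂ) : Prop where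
  notMem : h ∉ L.lattice
  two_mul_mem : 2 * h ∈ L.lattice

namespace IsHalfPeriod

variable {h : ℂ}

theorem two_le_meromorphicOrderAt (hh : IsHalfPeriod L h) :
    2 ≤ meromorphicOrderAt (fun w ↦ ℘[L] w - ℘[L] h) h :=
  two_le_meromorphicOrderAt_sub_of_deriv_eq_zero (L.analyticOnNhd_weierstrassP h hh.notMem)
    (by rw [L.deriv_weierstrassP, derivWeierstrassP_eq_zero_of_two_mul_mem hh.two_mul_mem])

theorem meromorphicOrderAt_add_translate_nonneg (hh : IsHalfPeriod L h) (z : ℂ) :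
    0 ≤ meromorphicOrderAt (fun w ↦ ℘[L] w - ℘[L] h) z +
      meromorphicOrderAt (fun w ↦ ℘[L] w - ℘[L] h) (z + h) := by
  have hQ := isElliptic_weierstrassP_sub_const L (℘[L] h)
  have hpole (l : ℂ) (hl : l ∈ L.lattice) : 0 ≤ meromorphicOrderAt (fun w ↦ ℘[L] w - ℘[L] h) l +
      meromorphicOrderAt (fun w ↦ ℘[L] w - ℘[L] h) (l + h) := by
    rw [meromorphicOrderAt_weierstrassP_sub_const_of_mem _ hl, add_comm l,
      hQ.meromorphicOrderAt_add_mem h hl]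
    calc (0 : WithTop ℤ) = -2 + 2 := rfl
      _ ≤ _ := by gcongr; exact hh.two_le_meromorphicOrderAt
  by_cases hz : z ∈ L.lattice
  · exact hpole z hz
  by_cases hzh : z + h ∈ L.lattice
  · have hswap := hpole (z + h) hzh
    rwa [add_assoc z, ← two_mul, hQ.meromorphicOrderAt_add_mem z hh.two_mul_mem, add_comm] at hswap
  · exact add_nonneg (analyticAt_weierstrassP_sub_const _ hz).meromorphicOrderAt_nonneg
      (analyticAt_weierstrassP_sub_const _ hzh).meromorphicOrderAt_nonneg

theorem exists_mul_translate_eventuallyEq (hh : IsHalfPeriod L h) :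
    ∃ c ≠ 0, (fun w ↦ (℘[L] w - ℘[L] h) * (℘[L] (w + h) - ℘[L] h))
      =ᶠ[codiscrete ℂ] fun _ ↦ c := by
  have hQ := isElliptic_weierstrassP_sub_const L (℘[L] h)
  obtain ⟨c, hc⟩ := (hQ.mul (hQ.comp_add_const h)).exists_eventuallyEq_const fun z ↦ by
    rw [meromorphicOrderAt_weierstrassP_sub_const_mul_translate]
    exact hh.meromorphicOrderAt_add_translate_nonneg z
  refine ⟨c, ?_, hc⟩
  rintro rfl
  have htop := meromorphicOrderAt_eq_top_iff.mpr (eventuallyEq_codiscrete_iff_nhdsNE.mp hc 0)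
  rw [meromorphicOrderAt_weierstrassP_sub_const_mul_translate, WithTop.add_eq_top] at htop
  exact htop.elim (meromorphicOrderAt_weierstrassP_sub_const_ne_top L _ _)
    (meromorphicOrderAt_weierstrassP_sub_const_ne_top L _ _)

theorem meromorphicOrderAt_add_translate (hh : IsHalfPeriod L h) (z : ℂ) :
    meromorphicOrderAt (fun w ↦ ℘[L] w - ℘[L] h) z +
      meromorphicOrderAt (fun w ↦ ℘[L] w - ℘[L] h) (z + h) = 0 := by
  classical
  obtain ⟨c, hc0, hc⟩ := hh.exists_mul_translate_eventuallyEq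
  rw [← meromorphicOrderAt_weierstrassP_sub_const_mul_translate,
    meromorphicOrderAt_congr (eventuallyEq_codiscrete_iff_nhdsNE.mp hc z),
    meromorphicOrderAt_const, if_neg hc0]

theorem add_mem_of_weierstrassP_eq (hh : IsHalfPeriod L h) (hz : z ∉ L.lattice)
    (he : ℘[L] z = ℘[L] h) : z + h ∈ L.lattice := by
  by_contra hzh
  have hpos := (analyticAt_weierstrassP_sub_const (℘[L] h) hz).meromorphicOrderAt_nonneg.lt_of_ne'
    ((weierstrassP_eq_iff_meromorphicOrderAt_ne_zero hz).mp he)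
  have hnonneg := (analyticAt_weierstrassP_sub_const (℘[L] h) hzh).meromorphicOrderAt_nonneg
  exact (add_pos_of_pos_of_nonneg hpos hnonneg).ne' (hh.meromorphicOrderAt_add_translate z)

theorem analyticOrderAt_eq_two (hh : IsHalfPeriod L h) :
    analyticOrderAt (fun w ↦ ℘[L] w - ℘[L] h) h = 2 := by
  have hsum := hh.meromorphicOrderAt_add_translate 0
  rw [zero_add, meromorphicOrderAt_weierstrassP_sub_const_of_mem _ L.lattice.zero_mem,
    (analyticAt_weierstrassP_sub_const _ hh.notMem).meromorphicOrderAt_eq] at hsum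
  cases hn : analyticOrderAt (fun w ↦ ℘[L] w - ℘[L] h) h with
  | top => simp [hn] at hsum
  | coe n =>
    rw [hn] at hsum
    have : (-2 + n : ℤ) = 0 := WithTop.coe_injective hsum
    exact congrArg _ (show n = 2 by lia)

end IsHalfPeriod

theorem isHalfPeriod_halfPeriod (L : PeriodPair) (p : Fin 3) : IsHalfPeriod L (L.halfPeriod p) where
  notMem := by
    fin_cases p
    · exact L.ω₁_div_two_notMem_lattice
    · exact L.ω₂_div_two_notMem_lattice
    · have hsum := (L.mul_ω₁_add_mul_ω₂_mem_lattice (α := -1 / 2) (β := -1 / 2)).not.mpr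
        (by norm_num)
      convert! hsum using 2
      simp only [PeriodPair.halfPeriod, Fin.reduceFinMk, Matrix.cons_val]
      push_cast
      ring
  two_mul_mem := by
    fin_cases p
    · simpa [PeriodPair.halfPeriod, mul_div_cancel₀] using L.ω₁_mem_lattice
    · simpa [PeriodPair.halfPeriod, mul_div_cancel₀] using L.ω₂_mem_lattice
    · have hsum := neg_mem (add_mem L.ω₁_mem_lattice L.ω₂_mem_lattice)
      simpa [PeriodPair.halfPeriod, mul_add, mul_div_cancel₀] using hsum

theorem halfPeriod_add_halfPeriod (L : PeriodPair) {p q : Fin 3} (hpq : p ≠ q) :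
    L.halfPeriod p + L.halfPeriod q = -L.halfPeriod (-(p + q)) := by
  have hsum : L.halfPeriod 0 + L.halfPeriod 1 + L.halfPeriod 2 = 0 := by
    simp [PeriodPair.halfPeriod]
  fin_cases p <;> fin_cases q <;> first
    | exact absurd rfl hpq
    | exact eq_neg_of_add_eq_zero_left (by grind)

theorem midpointConstant_injective (L : PeriodPair) : Function.Injective L.midpointConstant := by
  intro p q he
  by_contra hpq
  have hadd := (isHalfPeriod_halfPeriod L q).add_mem_of_weierstrassP_eq
    (isHalfPeriod_halfPeriod L p).notMem he
  rw [halfPeriod_add_halfPeriod L hpq, neg_mem_iff] at hadd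
  exact (isHalfPeriod_halfPeriod L _).notMem hadd

theorem weierstrassP_cubic_eq_zero_of_derivWeierstrassP_eq_zero (hz : z ∉ L.lattice)
    (hz' : ℘'[L] z = 0) : 4 * ℘[L] z ^ 3 - L.g₂ * ℘[L] z - L.g₃ = 0 := by
  rw [← L.derivWeierstrassP_sq z hz, hz', zero_pow two_ne_zero]

theorem g₃_eq_four_mul_prod_midpointConstant (L : PeriodPair) :
    L.g₃ = 4 * ∏ p, L.midpointConstant p := by
  have hroot (p : Fin 3) : 4 * L.midpointConstant p ^ 3 + 0 * L.midpointConstant p ^ 2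
      + -L.g₂ * L.midpointConstant p + -L.g₃ = 0 := by
    have hp := isHalfPeriod_halfPeriod L p
    have := weierstrassP_cubic_eq_zero_of_derivWeierstrassP_eq_zero hp.notMem
      (derivWeierstrassP_eq_zero_of_two_mul_mem hp.two_mul_mem)
    rw [PeriodPair.midpointConstant]
    linear_combination this
  rw [Fin.prod_univ_three]
  exact neg_injective (constCoeff_eq_of_cubic_roots
    ((midpointConstant_injective L).ne (by decide)) ((midpointConstant_injective L).ne (by decide))
    ((midpointConstant_injective L).ne (by decide)) (hroot 0) (hroot 1) (hroot 2))

theorem g₃_eq_zero_iff_exists_midpointConstant_eq_zero :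
    L.g₃ = 0 ↔ ∃ p, L.midpointConstant p = 0 := by
  simp [g₃_eq_four_mul_prod_midpointConstant L, Finset.prod_eq_zero_iff]

theorem existsUnique_midpointConstant_eq_zero (hg : L.g₃ = 0) : ∃! p, L.midpointConstant p = 0 := by
  obtain ⟨p, hp⟩ := g₃_eq_zero_iff_exists_midpointConstant_eq_zero.mp hg
  exact ⟨p, hp, fun q hq ↦ midpointConstant_injective L (hq.trans hp.symm)⟩

theorem analyticOrderAt_weierstrassP_eq_one (hg : L.g₃ ≠ 0) (hz : z ∉ L.lattice)
    (h0 : ℘[L] z = 0) : analyticOrderAt ℘[L] z = 1 := by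
  refine (L.analyticOnNhd_weierstrassP z hz).analyticOrderAt_eq_one_of_zero_deriv_ne_zero h0
    fun hd ↦ hg ?_
  rw [L.deriv_weierstrassP] at hd
  simpa [h0] using weierstrassP_cubic_eq_zero_of_derivWeierstrassP_eq_zero hz hd

theorem g₃_eq_zero_of_isMeromorphicSqrt_weierstrassP {J : ℂ → ℂ} (hJ : IsMeromorphicSqrt J ℘[L]) :
    L.g₃ = 0 := by
  by_contra hg
  obtain ⟨z, hz, h0⟩ := exists_weierstrassP_eq L 0
  apply hJ.meromorphicOrderAt_ne_one z
  rw [(L.analyticOnNhd_weierstrassP z hz).meromorphicOrderAt_eq,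
    analyticOrderAt_weierstrassP_eq_one hg hz h0]
  rfl

end WeierstrassP

section HalfLogDeriv

variable {M : PeriodPair} {h z : ℂ}

open scoped PeriodPair

/-- The logarithmic derivative of `℘[M] - ℘[M] h`, scaled to have residue `1` at the origin. For a
half period `h` of `M` it is a primitive function of the lattice obtained from that of `M` by
adjoining `h`. -/
noncomputable def halfLogDeriv (M : PeriodPair) (h z : ℂ) : ℂ :=
  -(logDeriv (fun w ↦ ℘[M] w - ℘[M] h) z / 2)

theorem halfLogDeriv_eq (M : PeriodPair) (h z : ℂ) :
    halfLogDeriv M h z = -(℘'[M] z / (℘[M] z - ℘[M] h) / 2) := by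
  rw [halfLogDeriv, logDeriv_apply, deriv_sub_const, M.deriv_weierstrassP]

theorem halfLogDeriv_eq_zero_of_two_mul_mem (hz : 2 * z ∈ M.lattice) : halfLogDeriv M h z = 0 := by
  simp [halfLogDeriv_eq, derivWeierstrassP_eq_zero_of_two_mul_mem hz]

theorem isElliptic_halfLogDeriv (M : PeriodPair) (h : ℂ) :
    IsElliptic M.lattice (halfLogDeriv M h) where
  meromorphic := by
    have := (isElliptic_weierstrassP_sub_const M (℘[M] h)).meromorphic.logDeriv
    exact (this.div (.const 2)).neg
  periodic l hl := .of_eq (funext fun z ↦ by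
    simp only [halfLogDeriv_eq, M.weierstrassP_add_coe z ⟨l, hl⟩,
      M.derivWeierstrassP_add_coe z ⟨l, hl⟩])

theorem tendsto_mul_halfLogDeriv (M : PeriodPair) (h : ℂ) :
    Tendsto (fun z ↦ z * halfLogDeriv M h z) (𝓝[≠] 0) (𝓝 1) := by
  have hlim := tendsto_mul_logDeriv_of_meromorphicOrderAt (n := -2)
    ((isElliptic_weierstrassP_sub_const M (℘[M] h)).meromorphic 0)
    (meromorphicOrderAt_weierstrassP_sub_const_of_mem _ M.lattice.zero_mem)
  convert! hlim.div_const (-2) using 2 with z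
  · rw [halfLogDeriv]
    ring
  · norm_num

theorem halfLogDeriv_sq (hh : IsHalfPeriod M h) (hz : z ∉ M.lattice) (hzh : ℘[M] z ≠ ℘[M] h) :
    halfLogDeriv M h z ^ 2 =
      ℘[M] z + 2 * ℘[M] h + (3 * ℘[M] h ^ 2 - M.g₂ / 4) * (℘[M] z - ℘[M] h)⁻¹ := by
  have hcubic := weierstrassP_cubic_eq_zero_of_derivWeierstrassP_eq_zero hh.notMem
    (derivWeierstrassP_eq_zero_of_two_mul_mem hh.two_mul_mem)
  have hne := sub_ne_zero.mpr hzh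
  rw [halfLogDeriv_eq, neg_sq, div_pow, div_pow, M.derivWeierstrassP_sq z hz]
  field_simp
  linear_combination 4 * hcubic

theorem IsHalfPeriod.halfLogDeriv_add_eventuallyEq (hh : IsHalfPeriod M h) :
    (fun z ↦ halfLogDeriv M h (z + h)) =ᶠ[codiscrete ℂ] fun z ↦ -halfLogDeriv M h z := by
  have hQ := isElliptic_weierstrassP_sub_const M (℘[M] h)
  have hQ_ne_top := meromorphicOrderAt_weierstrassP_sub_const_ne_top M (℘[M] h)
  obtain ⟨c, -, hc⟩ := hh.exists_mul_translate_eventuallyEq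
  have hmul := hQ.meromorphic.logDeriv_mul_eventuallyEq (hQ.comp_add_const h).meromorphic hQ_ne_top
    fun z ↦ (meromorphicOrderAt_comp_add_const (fun w ↦ ℘[M] w - ℘[M] h) h z).trans_ne
      (hQ_ne_top (z + h))
  filter_upwards [hmul, logDeriv_congr_codiscrete hc] with z hz hcz
  have hsum := hz.symm.trans hcz
  rw [logDeriv_const, Pi.add_apply, logDeriv_comp_add_const (fun w ↦ ℘[M] w - ℘[M] h),
    Pi.zero_apply] at hsum
  simp only [halfLogDeriv]
  linear_combination -hsum / 2

end HalfLogDeriv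

section Doubling

variable {L M : PeriodPair} {a h z : ℂ}

open scoped PeriodPair

theorem tendsto_weierstrassP_sub_weierstrassP (L M : PeriodPair) :
    Tendsto (fun z ↦ ℘[M] z - ℘[L] z) (𝓝[≠] 0) (𝓝 0) := by
  have hcont : ContinuousAt (fun z ↦ ℘[M - (0 : ℂ)] z - ℘[L - (0 : ℂ)] z) 0 :=
    (M.analyticAt_weierstrassPExcept 0).continuousAt.sub
      (L.analyticAt_weierstrassPExcept 0).continuousAt
  have hlim := hcont.tendsto.mono_left (nhdsWithin_le_nhds (s := {0}ᶜ))
  simp only [PeriodPair.weierstrassPExcept_zero, sub_zero] at hlim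
  refine hlim.congr fun z ↦ ?_
  have hL := L.weierstrassPExcept_add 0 z
  have hM := M.weierstrassPExcept_add 0 z
  simp only [Submodule.coe_zero] at hL hM
  linear_combination hM - hL

theorem eventually_notMem_lattice (L : PeriodPair) (x : ℂ) : ∀ᶠ z in 𝓝[≠] x, z ∉ L.lattice := by
  filter_upwards [self_mem_nhdsWithin,
    mem_nhdsWithin_of_mem_nhds (L.compl_lattice_sdiff_singleton_mem_nhds x)] with z hzx hz
  simp_all

/-- The lattice of `L` contains the lattice of `M` with index two, and `h` represents its nonzero
coset. -/
structure IsDoubling (L M : PeriodPair) (h : ℂ) : Prop where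
  isHalfPeriod : IsHalfPeriod M h
  mem_lattice_iff : ∀ {z}, z ∈ L.lattice ↔ z ∈ M.lattice ∨ z + h ∈ M.lattice

namespace IsDoubling

theorem notMem_lattice (hd : IsDoubling L M h) (hz : z ∉ L.lattice) : z ∉ M.lattice :=
  fun hzM ↦ hz (hd.mem_lattice_iff.mpr (.inl hzM))

theorem weierstrassP_ne (hd : IsDoubling L M h) (hz : z ∉ L.lattice) : ℘[M] z ≠ ℘[M] h :=
  fun he ↦ hz (hd.mem_lattice_iff.mpr
    (.inr (hd.isHalfPeriod.add_mem_of_weierstrassP_eq (hd.notMem_lattice hz) he)))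

theorem analyticAt_halfLogDeriv (hd : IsDoubling L M h) (hz : z ∉ L.lattice) :
    AnalyticAt ℂ (halfLogDeriv M h) z := by
  have hQ := analyticAt_weierstrassP_sub_const (℘[M] h) (hd.notMem_lattice hz)
  exact ((hQ.deriv.div hQ (sub_ne_zero.mpr (hd.weierstrassP_ne hz))).div_const).neg

theorem isElliptic_halfLogDeriv_sq (hd : IsDoubling L M h) :
    IsElliptic L.lattice fun z ↦ halfLogDeriv M h z ^ 2 where
  meromorphic z := ((isElliptic_halfLogDeriv M h).meromorphic z).fun_pow 2
  periodic l hl := by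
    rcases hd.mem_lattice_iff.mp hl with hl | hl
    · exact ((isElliptic_halfLogDeriv M h).periodic l hl).fun_comp (· ^ 2)
    · have hshift := hd.isHalfPeriod.halfLogDeriv_add_eventuallyEq.comp_tendsto
        (tendsto_codiscrete_of_homeomorph (Homeomorph.addRight l))
      filter_upwards [hshift, (isElliptic_halfLogDeriv M h).periodic (l + h) hl] with z hz hzl
      simp only [Function.comp_apply, Homeomorph.coe_addRight, add_assoc] at hz
      rw [← hzl, hz, neg_sq]

theorem tendsto_halfLogDeriv_sq_sub (hd : IsDoubling L M h) :
    Tendsto (fun z ↦ halfLogDeriv M h z ^ 2 - (℘[L] z - -(2 * ℘[M] h))) (𝓝[≠] 0) (𝓝 0) := by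
  have hinv : Tendsto (fun z ↦ (℘[M] z - ℘[M] h)⁻¹) (𝓝[≠] 0) (𝓝 0) := by
    refine tendsto_inv₀_cobounded.comp (tendsto_cobounded_of_meromorphicOrderAt_neg ?_)
    rw [meromorphicOrderAt_weierstrassP_sub_const_of_mem _ M.lattice.zero_mem]
    decide
  have hlim := (tendsto_weierstrassP_sub_weierstrassP L M).add
    (hinv.const_mul (3 * ℘[M] h ^ 2 - M.g₂ / 4))
  rw [mul_zero, add_zero] at hlim
  refine hlim.congr' ?_
  filter_upwards [eventually_notMem_lattice L 0] with z hz
  rw [halfLogDeriv_sq hd.isHalfPeriod (hd.notMem_lattice hz) (hd.weierstrassP_ne hz)]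
  ring

theorem isMeromorphicSqrt_halfLogDeriv (hd : IsDoubling L M h) :
    IsMeromorphicSqrt (halfLogDeriv M h) fun z ↦ ℘[L] z - -(2 * ℘[M] h) := by
  set F : ℂ → ℂ := fun z ↦ halfLogDeriv M h z ^ 2 - (℘[L] z - -(2 * ℘[M] h))
  have hF : IsElliptic L.lattice F :=
    hd.isElliptic_halfLogDeriv_sq.sub (isElliptic_weierstrassP_sub_const L _)
  have hlim : Tendsto F (𝓝[≠] 0) (𝓝 0) := hd.tendsto_halfLogDeriv_sq_sub
  obtain ⟨c, hc⟩ := hF.exists_eventuallyEq_const fun z ↦ by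
    by_cases hz : z ∈ L.lattice
    · rw [← zero_add z, hF.meromorphicOrderAt_add_mem 0 hz]
      exact (tendsto_nhds_iff_meromorphicOrderAt_nonneg (hF.meromorphic 0)).mp ⟨0, hlim⟩
    · exact (((hd.analyticAt_halfLogDeriv hz).pow 2).sub
        (analyticAt_weierstrassP_sub_const _ hz)).meromorphicOrderAt_nonneg
  have hc0 : c = 0 := tendsto_nhds_unique
    (tendsto_const_nhds.congr' (eventuallyEq_codiscrete_iff_nhdsNE.mp hc 0).symm) hlim
  refine ⟨(isElliptic_halfLogDeriv M h).meromorphic, ?_⟩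
  filter_upwards [hc] with z hz
  exact sub_eq_zero.mp (hz.trans hc0)

theorem weierstrassP_eq_neg_two_mul (hd : IsDoubling L M h) (ha : a ∉ L.lattice)
    (ha' : 2 * a ∈ M.lattice) : ℘[L] a = -(2 * ℘[M] h) := by
  have heq := (((hd.analyticAt_halfLogDeriv ha).pow 2).continuousAt
    |>.eventuallyEq_nhds_iff_eventuallyEq_nhdsNE
      (analyticAt_weierstrassP_sub_const (-(2 * ℘[M] h)) ha).continuousAt).mp
    (eventuallyEq_codiscrete_iff_nhdsNE.mp hd.isMeromorphicSqrt_halfLogDeriv.2 a)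
  have hval := heq.eq_of_nhds
  simp only [Pi.pow_apply, halfLogDeriv_eq_zero_of_two_mul_mem ha', zero_pow two_ne_zero] at hval
  exact sub_eq_zero.mp hval.symm

end IsDoubling

end Doubling

section PrimitiveFunction

theorem linearIndependent_halfPeriod (L : PeriodPair) (p : Fin 3) :
    LinearIndependent ℝ ![L.halfPeriod p, L.halfPeriod (p + 1)] := by
  have hL := LinearIndependent.pair_iff.mp L.indep
  rw [LinearIndependent.pair_iff]
  intro s t hst
  simp only [Complex.real_smul] at hL hst
  fin_cases p <;> simp only [PeriodPair.halfPeriod, Fin.zero_eta, Fin.mk_one, Fin.reduceFinMk,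
    Fin.isValue, Fin.reduceAdd, zero_add, Matrix.cons_val_zero, Matrix.cons_val_one,
    Matrix.cons_val] at hst
  · exact hL s t (by linear_combination 2 * hst)
  · have := hL (-t) (s - t) (by push_cast; linear_combination 2 * hst)
    grind
  · have := hL (t - s) (-s) (by push_cast; linear_combination 2 * hst)
    grind

theorem mem_lattice_iff_halfPeriod (L : PeriodPair) (p : Fin 3) {z : ℂ} :
    z ∈ L.lattice ↔ ∃ m n : ℤ, m * (2 * L.halfPeriod p) + n * (2 * L.halfPeriod (p + 1)) = z := by
  rw [PeriodPair.mem_lattice]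
  constructor
  · rintro ⟨m, n, rfl⟩
    fin_cases p <;> simp only [PeriodPair.halfPeriod, Fin.zero_eta, Fin.mk_one, Fin.reduceFinMk,
      Fin.isValue, Fin.reduceAdd, zero_add, Matrix.cons_val_zero, Matrix.cons_val_one,
      Matrix.cons_val]
    · exact ⟨m, n, by ring⟩
    · exact ⟨n - m, -m, by push_cast; ring⟩
    · exact ⟨-n, m - n, by push_cast; ring⟩
  · rintro ⟨m, n, rfl⟩
    have hmem (q : Fin 3) := (isHalfPeriod_halfPeriod L q).two_mul_mem
    simpa only [PeriodPair.mem_lattice, zsmul_eq_mul] using add_mem (L.lattice.smul_mem m (hmem p))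
      (L.lattice.smul_mem n (hmem (p + 1)))

/-- A sublattice of index two of the lattice of `L`, for which `2 * L.halfPeriod (p + 1)` is a half
period. It is the choice for which `L.halfPeriod p` stays a half period, and the other two half
periods of `L` do not. -/
noncomputable def doubling (L : PeriodPair) (p : Fin 3) : PeriodPair where
  ω₁ := 2 * L.halfPeriod p
  ω₂ := 2 * (2 * L.halfPeriod (p + 1))
  indep := by
    have h := LinearIndependent.pair_iff.mp (linearIndependent_halfPeriod L p)
    rw [LinearIndependent.pair_iff]
    intro s t hst
    have hst' := h s (2 * t) (by
      simp only [Complex.real_smul] at hst ⊢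
      push_cast
      linear_combination hst / 2)
    simpa using hst'

theorem isDoubling_doubling (L : PeriodPair) (p : Fin 3) :
    IsDoubling L (doubling L p) (2 * L.halfPeriod (p + 1)) where
  isHalfPeriod := by
    simpa [PeriodPair.halfPeriod, doubling] using isHalfPeriod_halfPeriod (doubling L p) 1
  mem_lattice_iff {z} := by
    rw [mem_lattice_iff_halfPeriod L p]
    simp only [PeriodPair.mem_lattice, doubling]
    constructor
    · rintro ⟨m, n, rfl⟩
      rcases Int.even_or_odd' n with ⟨k, rfl | rfl⟩
      · exact .inl ⟨m, k, by push_cast; ring⟩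
      · exact .inr ⟨m, k + 1, by push_cast; ring⟩
    · rintro (⟨m, n, rfl⟩ | ⟨m, n, hz⟩)
      · exact ⟨m, 2 * n, by push_cast; ring⟩
      · exact ⟨m, 2 * n - 1, by push_cast; linear_combination hz⟩

theorem isMeromorphicSqrt_halfLogDeriv_doubling (L : PeriodPair) (p : Fin 3) :
    IsMeromorphicSqrt (halfLogDeriv (doubling L p) (2 * L.halfPeriod (p + 1)))
      fun z ↦ L.weierstrassP z - L.midpointConstant p := by
  have hd := isDoubling_doubling L p
  have hp := (isHalfPeriod_halfPeriod L p).notMem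
  rw [PeriodPair.midpointConstant,
    hd.weierstrassP_eq_neg_two_mul hp (doubling L p).ω₁_mem_lattice]
  exact hd.isMeromorphicSqrt_halfLogDeriv

theorem exists_isPrimitiveFunction (L : PeriodPair) (p : Fin 3) :
    ∃ J, L.IsPrimitiveFunction p J := by
  set J := halfLogDeriv (doubling L p) (2 * L.halfPeriod (p + 1))
  have hJ : IsMeromorphicSqrt J _ := isMeromorphicSqrt_halfLogDeriv_doubling L p
  have hNF := meromorphicNFOn_toMeromorphicNFOn J Set.univ
  have hJNF : J =ᶠ[codiscrete ℂ] toMeromorphicNFOn J Set.univ :=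
    toMeromorphicNFOn_eqOn_codiscrete hJ.1.meromorphicOn
  refine ⟨_, hNF, hJ.congr_left (fun z ↦ (hNF (Set.mem_univ z)).meromorphicAt) hJNF, ?_⟩
  refine (tendsto_mul_halfLogDeriv (doubling L p) (2 * L.halfPeriod (p + 1))).congr' ?_
  exact .mul .rfl (eventuallyEq_codiscrete_iff_nhdsNE.mp hJNF 0)

theorem existsUnique_isPrimitiveFunction (L : PeriodPair) (p : Fin 3) :
    ∃! J, L.IsPrimitiveFunction p J := by
  obtain ⟨J, hJ⟩ := exists_isPrimitiveFunction L p
  exact ⟨J, hJ, fun K hK ↦ eq_of_meromorphicNFOn_univ hK.1 hJ.1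
    (hK.2.1.eventuallyEq_of_tendsto hJ.2.1 one_ne_zero hK.2.2 hJ.2.2)⟩

end PrimitiveFunction

theorem mainTheorem1 (L : PeriodPair) :
    (L.g₃ = 0 →
      (∃! p : Fin 3, L.midpointConstant p = 0) ∧
      ∀ p : Fin 3, L.midpointConstant p = 0 →
        analyticOrderAt L.weierstrassP (L.halfPeriod p) = 2 ∧
        (∃! J : ℂ → ℂ, L.IsPrimitiveFunction p J) ∧
        (∀ J : ℂ → ℂ, L.IsPrimitiveFunction p J → IsMeromorphicSqrt J L.weierstrassP)) ∧
    (L.g₃ ≠ 0 →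
      (∀ p : Fin 3, L.midpointConstant p ≠ 0) ∧
      (∀ z : ℂ, z ∉ L.lattice → L.weierstrassP z = 0 →
        analyticOrderAt L.weierstrassP z = 1) ∧
      ¬ ∃ J : ℂ → ℂ, IsMeromorphicSqrt J L.weierstrassP) ∧
    ((∃ J : ℂ → ℂ, IsMeromorphicSqrt J L.weierstrassP) ↔ L.g₃ = 0) := by
  have hsqrt (p : Fin 3) (hp : L.midpointConstant p = 0) (J : ℂ → ℂ)
      (hJ : L.IsPrimitiveFunction p J) : IsMeromorphicSqrt J L.weierstrassP := by
    simpa [hp] using hJ.2.1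
  have hno : (∃ J, IsMeromorphicSqrt J L.weierstrassP) → L.g₃ = 0 := fun ⟨_, hJ⟩ ↦
    g₃_eq_zero_of_isMeromorphicSqrt_weierstrassP hJ
  refine ⟨fun hg ↦ ⟨existsUnique_midpointConstant_eq_zero hg, fun p hp ↦
      ⟨?_, existsUnique_isPrimitiveFunction L p, hsqrt p hp⟩⟩,
    fun hg ↦ ⟨fun p hp ↦ hg (g₃_eq_zero_iff_exists_midpointConstant_eq_zero.mpr ⟨p, hp⟩),
      fun z ↦ analyticOrderAt_weierstrassP_eq_one hg, mt hno hg⟩, hno, fun hg ↦ ?_⟩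
  · have horder := (isHalfPeriod_halfPeriod L p).analyticOrderAt_eq_two
    rw [← PeriodPair.midpointConstant, hp] at horder
    simpa only [sub_zero] using horder
  · obtain ⟨p, hp⟩ := g₃_eq_zero_iff_exists_midpointConstant_eq_zero.mp hg
    obtain ⟨J, hJ⟩ := exists_isPrimitiveFunction L p
    exact ⟨J, hsqrt p hp J hJ⟩
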